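/- A space $Z$ is *orderable* if its topology is the order topology of some linear order on $Z$, and *suborderable* if it is homeomorphic to a subspace of an orderable space. For a set $E$, let $\mathcal F_2(E)=\{F\subset E: 1\le |F|\le 2\}$. A *weak selection* on $E$ is a map $\sigma:\mathcal F_2(E)\to E$ with $\sigma(F)\in F$ for all $F$; write $x\prec_\sigma y$ if $x\ne y$ and $\sigma(\{x,y\})=x$. A weak selection $\sigma$ on a topological space $E$ is *separately continuous* if for every $x\in E$ the sets $\{z: z\prec_\sigma x\}$ and $\{z: x\prec_\sigma z\}$ are open in $E$ (equivalently, the topology generated by all these sets is contained in the topology of $E$). For a non-isolated point $p$ of a space $X$ let $a(p,X)$ be the least cardinal $\kappa$ such that $p\in\overline A$ for some $A\subset X\setminus\{p\}$ with $|A|\le\kappa$, and for non-discrete $X$ let $a(X)=\min\{a(p,X): p \text{ a non-isolated point of } X\}$. For $p\in X$ let $\psi(p,X)$ be the least cardinal $\kappa$ such that $\{p\}$ is the intersection of $\kappa$ many open subsets of $X$, and let $\psi(X)=\sup\{\psi(p,X):p\in X\}$. **Corollary.** Let $X$ be a non-discrete Hausdorff space that is the image of a suborderable space under a closed continuous map.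 If $X\times X$ (with the product topology) admits a separately continuous weak selection, then $X$ is hereditarily paracompact (every subspace of $X$ is paracompact), $X$ is totally disconnected (any two distinct points of $X$ are separated by a clopen set), and $\psi(X)\le a(X)$. -/

import Mathlib

open Cardinal
open scoped Topology

universe u v w

/-- A space is orderable if its topology is the order topology of some linear order. -/
def OrderableSpace (L : Type w) [TopologicalSpace L] : Prop :=
  ∃ _ : LinearOrder L, OrderTopology L

/-- A space is suborderable if it is (homeomorphic to) a subspace of an orderable space. -/
def SuborderableSpace (Z : Type v) [TopologicalSpace Z] : Prop :=
  ∃ (L : Type w) (_ : TopologicalSpace L),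
    OrderableSpace L ∧ ∃ e : Z → L, Topology.IsEmbedding e

/-- The set of all nonempty subsets of `X` with at most two points. -/
def FTwo (X : Type u) : Type u :=
  {F : Set X // 1 ≤ F.encard ∧ F.encard ≤ 2}

/-- The unordered pair `{x, y}` as an element of `FTwo X` (a singleton if `x = y`). -/
def FTwo.pair {X : Type u} (x y : X) : FTwo X :=
  ⟨{x, y}, Set.one_le_encard_iff_nonempty.mpr ⟨x, Set.mem_insert x {y}⟩,
    (Set.encard_insert_le {y} x).trans (by rw [Set.encard_singleton]; norm_num)⟩

/-- A weak selection on `X` picks a point of each nonempty subset with at most two points. -/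
def IsWeakSelection {X : Type u} (σ : FTwo X → X) : Prop :=
  ∀ F : FTwo X, σ F ∈ F.1

/-- The relation `x ⪯ y` determined by a weak selection: `σ {x, y} = x`. -/
def selLE {X : Type u} (σ : FTwo X → X) (x y : X) : Prop :=
  σ (FTwo.pair x y) = x

/-- The strict relation `x ≺ y`: `x ⪯ y` and `x ≠ y`. -/
def selLT {X : Type u} (σ : FTwo X → X) (x y : X) : Prop :=
  selLE σ x y ∧ x ≠ y

/-- The selection topology, generated by the open half-intervals of the selection relation. -/
@[reducible]
def selectionTopology {X : Type u} (σ : FTwo X → X) : TopologicalSpace X :=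
  TopologicalSpace.generateFrom
    {s | ∃ x : X, s = {z | selLT σ z x} ∨ s = {z | selLT σ x z}}

/-- A weak selection on a space is separately continuous if every set that is open in the
selection topology is open in the space. -/
def IsSeparatelyContinuousSelection {X : Type u} [TopologicalSpace X] (σ : FTwo X → X) : Prop :=
  ∀ U : Set X, IsOpen[selectionTopology σ] U → IsOpen U

/-- The space `X` admits a separately continuous weak selection. -/
def AdmitsSepContWeakSelection (X : Type u) [TopologicalSpace X] : Prop :=
  ∃ σ : FTwo X → X, IsWeakSelection σ ∧ IsSeparatelyContinuousSelection σ

/-- Every subspace is paracompact (used for Hausdorff spaces only). -/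
def HereditarilyParacompact (X : Type u) [TopologicalSpace X] : Prop :=
  ∀ A : Set X, ParacompactSpace A

/-- The approaching number `a(p, X)` of a non-isolated point `p`: the least `κ` such that `p` is in
the closure of some `A ⊆ X \ {p}` of cardinality at most `κ`. -/
noncomputable def approachingNumberAt (X : Type u) [TopologicalSpace X] (p : X) : Cardinal.{u} :=
  sInf {κ | ∃ A : Set X, A ⊆ {p}ᶜ ∧ p ∈ closure A ∧ #A ≤ κ}

/-- The approaching number `a(X)` of a non-discrete space: the minimum of `a(p, X)` over all
non-isolated points `p`. -/
noncomputable def approachingNumber (X : Type u) [TopologicalSpace X] : Cardinal.{u} :=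
  sInf {κ | ∃ p : X, ¬ IsOpen ({p} : Set X) ∧ κ = approachingNumberAt X p}

/-- The pseudo-character `ψ(p, X)`: the least `κ` such that `{p}` is the intersection of a family of
`κ` open sets. -/
noncomputable def pseudoCharacterAt (X : Type u) [TopologicalSpace X] (p : X) : Cardinal.{u} :=
  sInf {κ | ∃ 𝒰 : Set (Set X), (∀ U ∈ 𝒰, IsOpen U) ∧ ⋂₀ 𝒰 = {p} ∧ #𝒰 = κ}

/-- The pseudo-character `ψ(X)`, the supremum of `ψ(p, X)` over all points (a supremum over a small
family of cardinals, hence a genuine one). -/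
noncomputable def pseudoCharacter (X : Type u) [TopologicalSpace X] : Cardinal.{u} :=
  ⨆ p : X, pseudoCharacterAt X p

/-!
Fix a tournament with open in- and out-neighbourhoods on `X × X`, and points `xᵢ ≠ p` accumulating
at `p`. The relations `(xᵢ, y) → (p, z) ↔ (xᵢ, z) → (p, y)` in `y` and `z` are separately clopen,
since the first coordinates differ; they intersect in the diagonal, since they fail for `xᵢ` close
to `p` when `y ≠ z`. Their number bounds `ψ(X)`, and they separate points by clopen sets.

On a regular well-order, a map to `X` that is left-continuous on a stationary set of limits is
therefore eventually constant. In a suborderable `Z` mapping onto `X`, follow a regular well-ordered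
cofinal sequence in a clopen set `C`: if its gaps are non-stationary, a club splits `C` into a
locally finite family of closed bounded pieces, and otherwise the images of its limit points are
eventually constant, so that a pressing-down argument puts a whole tail of `C` into one member of
the pulled-back cover. Hence this cover has a locally finite closed refinement, whose image under
the closed map is closure-preserving, and Michael's theorem gives paracompactness.
-/

/-- A tournament on a space all of whose out-neighbourhoods and in-neighbourhoods are open. -/
structure IsOpenTournament {E : Type*} [TopologicalSpace E] (R : E → E → Prop) : Prop where
  total : ∀ {x y}, x ≠ y → R x y ∨ R y x
  asymm : ∀ {x y}, R x y → ¬ R y x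
  isOpen_right : ∀ x, IsOpen {y | R x y}
  isOpen_left : ∀ x, IsOpen {y | R y x}

theorem FTwo.pair_comm {E : Type u} (x y : E) : FTwo.pair x y = FTwo.pair y x :=
  Subtype.ext (Set.pair_comm x y)

theorem AdmitsSepContWeakSelection.exists_isOpenTournament {E : Type u} [TopologicalSpace E]
    (h : AdmitsSepContWeakSelection E) : ∃ R : E → E → Prop, IsOpenTournament R := by
  obtain ⟨σ, hσ, hcont⟩ := h
  refine ⟨selLT σ, fun {x y} hxy => ?_, fun {x y} hxy hyx => ?_, fun x => ?_, fun x => ?_⟩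
  · rcases hσ (FTwo.pair x y) with hx | hy
    · exact .inl ⟨hx, hxy⟩
    · exact .inr ⟨(congrArg σ (FTwo.pair_comm y x)).trans hy, hxy.symm⟩
  · exact hxy.2 (hxy.1.symm.trans <| (congrArg σ (FTwo.pair_comm x y)).trans hyx.1)
  · exact hcont _ (TopologicalSpace.isOpen_generateFrom_of_mem ⟨x, .inr rfl⟩)
  · exact hcont _ (TopologicalSpace.isOpen_generateFrom_of_mem ⟨x, .inl rfl⟩)

/-- A family of symmetric, separately clopen relations whose intersection is equality. -/
structure IsClopenDiagonalFamily {ι X : Type*} [TopologicalSpace X] (E : ι → X → X → Prop) :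
    Prop where
  symm : ∀ {i x y}, E i x y → E i y x
  isClopen : ∀ i x, IsClopen {y | E i x y}
  forall_iff_eq : ∀ {x y}, (∀ i, E i x y) ↔ x = y

namespace IsOpenTournament

section

variable {E F : Type*} [TopologicalSpace E] [TopologicalSpace F] {R : E → E → Prop}

theorem comap (hR : IsOpenTournament R) {e : F → E} (he : Continuous e)
    (hinj : Function.Injective e) : IsOpenTournament fun x y => R (e x) (e y) where
  total hxy := hR.total (hinj.ne hxy)
  asymm := hR.asymm
  isOpen_right x := (hR.isOpen_right (e x)).preimage he
  isOpen_left x := (hR.isOpen_left (e x)).preimage he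

theorem flip (hR : IsOpenTournament R) : IsOpenTournament fun x y => R y x where
  total hxy := (hR.total hxy).symm
  asymm := hR.asymm
  isOpen_right := hR.isOpen_left
  isOpen_left := hR.isOpen_right

theorem isClopen_preimage_right (hR : IsOpenTournament R) {e : F → E} (he : Continuous e) {x : E}
    (hx : ∀ y, x ≠ e y) : IsClopen {y | R x (e y)} := by
  have hcompl : {y | R x (e y)}ᶜ = {y | R (e y) x} := by
    ext y
    exact ⟨(hR.total (hx y)).resolve_left, hR.asymm⟩
  refine ⟨⟨?_⟩, (hR.isOpen_right x).preimage he⟩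
  rw [hcompl]
  exact (hR.isOpen_left x).preimage he

end

variable {ι X : Type*} [TopologicalSpace X] {R : X × X → X × X → Prop}

theorem exists_rel_of_mem_closure (hR : IsOpenTournament R) {p y z : X} {A : Set X}
    (hp : p ∈ closure A) (h : R (p, y) (p, z)) :
    ∃ x ∈ A, R (x, y) (p, z) ∧ ¬ R (x, z) (p, y) := by
  have hnear : {x | R (x, y) (p, z)} ∩ {x | R (p, y) (x, z)} ∈ 𝓝 p :=
    ((hR.isOpen_left (p, z)).preimage (Continuous.prodMk_left y)).inter
      ((hR.isOpen_right (p, y)).preimage (Continuous.prodMk_left z)) |>.mem_nhds ⟨h, h⟩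
  obtain ⟨x, ⟨hxy, hxz⟩, hxA⟩ := mem_closure_iff_nhds.1 hp _ hnear
  exact ⟨x, hxA, hxy, hR.asymm hxz⟩

theorem isClopenDiagonalFamily (hR : IsOpenTournament R) {p : X} {x : ι → X}
    (hx : ∀ i, x i ≠ p) (hp : p ∈ closure (Set.range x)) :
    IsClopenDiagonalFamily fun i y z => (R (x i, y) (p, z) ↔ R (x i, z) (p, y)) where
  symm := Iff.symm
  isClopen i y := by
    have hright : IsClopen {z | R (x i, y) (p, z)} :=
      hR.isClopen_preimage_right (Continuous.prodMk_right p) fun z h => hx i (congrArg Prod.fst h)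
    have hleft : IsClopen {z | R (x i, z) (p, y)} :=
      hR.flip.isClopen_preimage_right (Continuous.prodMk_right (x i))
        fun z h => hx i (congrArg Prod.fst h).symm
    have hiff : {z | R (x i, y) (p, z) ↔ R (x i, z) (p, y)} =
        ({z | R (x i, y) (p, z)} ⇨ {z | R (x i, z) (p, y)}) ⊓
          ({z | R (x i, z) (p, y)} ⇨ {z | R (x i, y) (p, z)}) := by
      ext z
      exact iff_iff_implies_and_implies
    rw [hiff]
    exact (hright.himp hleft).inter (hleft.himp hright)
  forall_iff_eq {y z} := by
    refine ⟨fun h => ?_, fun h i => by rw [h]⟩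
    by_contra hyz
    rcases hR.total (x := (p, y)) (y := (p, z)) (by simpa using hyz) with hyz | hzy
    · obtain ⟨_, ⟨i, rfl⟩, hi, hi'⟩ := hR.exists_rel_of_mem_closure hp hyz
      exact hi' ((h i).1 hi)
    · obtain ⟨_, ⟨i, rfl⟩, hi, hi'⟩ := hR.exists_rel_of_mem_closure hp hzy
      exact hi' ((h i).2 hi)

end IsOpenTournament

theorem IsClopenDiagonalFamily.totallySeparatedSpace {ι X : Type*} [TopologicalSpace X]
    {E : ι → X → X → Prop} (hE : IsClopenDiagonalFamily E) : TotallySeparatedSpace X := by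
  refine totallySeparatedSpace_iff_exists_isClopen.2 fun x y hxy => ?_
  obtain ⟨i, hi⟩ := not_forall.1 (mt hE.forall_iff_eq.1 hxy)
  exact ⟨{z | E i x z}, hE.isClopen i x, hE.forall_iff_eq.2 rfl i, hi⟩

theorem IsClopenDiagonalFamily.pseudoCharacter_le {ι X : Type u} [TopologicalSpace X]
    {E : ι → X → X → Prop} (hE : IsClopenDiagonalFamily E) : pseudoCharacter X ≤ #ι := by
  refine ciSup_le' fun q => ?_
  calc pseudoCharacterAt X q ≤ #(Set.range fun i => {y | E i q y}) :=
        csInf_le' ⟨_, Set.forall_mem_range.2 fun i => (hE.isClopen i q).isOpen, ?_, rfl⟩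
    _ ≤ #ι := Cardinal.mk_range_le
  ext y
  simp only [Set.sInter_range, Set.mem_iInter, Set.mem_ofPred_eq, Set.mem_singleton_iff,
    hE.forall_iff_eq, eq_comm]

theorem exists_mem_closure_mk_le_approachingNumber {X : Type u} [TopologicalSpace X]
    (hX : ¬ DiscreteTopology X) :
    ∃ (p : X) (A : Set X), p ∉ A ∧ p ∈ closure A ∧ #A ≤ approachingNumber X := by
  have hne : {κ | ∃ p : X, ¬ IsOpen ({p} : Set X) ∧ κ = approachingNumberAt X p}.Nonempty := by
    rw [discreteTopology_iff_isOpen_singleton, not_forall] at hX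
    exact hX.imp' _ fun p hp => ⟨p, hp, rfl⟩
  obtain ⟨p, hp, hκ⟩ := csInf_mem hne
  have hp' : p ∈ closure {p}ᶜ := mem_closure_iff_nhdsWithin_neBot.2
    ⟨mt (isOpen_singleton_iff_punctured_nhds p).2 hp⟩
  have hne' : {κ | ∃ A : Set X, A ⊆ {p}ᶜ ∧ p ∈ closure A ∧ #A ≤ κ}.Nonempty :=
    ⟨_, {p}ᶜ, subset_rfl, hp', le_rfl⟩
  obtain ⟨A, hA, hpA, hcard⟩ := csInf_mem hne'
  exact ⟨p, A, fun h => hA h rfl, hpA, hcard.trans hκ.ge⟩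

section Stationary

variable {W : Type u} [LinearOrder W] [WellFoundedLT W] [IsRegularCardinalOrder W]

theorem exists_forall_lt_of_mk_lt {ι : Type u} (hι : #ι < #W) (g : ι → W) : ∃ b, ∀ i, g i < b := by
  have hg : ¬ IsCofinal (Set.range g) := fun h =>
    ((Order.cof_le h).trans Cardinal.mk_range_le).not_gt (Order.cof_eq_cardinalMk (α := W) ▸ hι)
  simpa only [not_isCofinal_iff, Set.forall_mem_range] using hg

theorem mk_Iio_lt_mk (a : W) : #(Set.Iio a) < #W :=
  Cardinal.mk_Iio_lt a Cardinal.ord_cardinalMk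

theorem aleph0_lt_mk_of_isSuccLimit {a : W} (ha : Order.IsSuccLimit a) : ℵ₀ < #W := by
  have hinf : (Set.Iio a).Infinite := fun hfin => by
    obtain ⟨m, hm⟩ := hfin.exists_maximal (not_isMin_iff.1 ha.not_isMin)
    obtain ⟨c, hca, hmc⟩ := ha.lt_iff_exists_lt.1 hm.prop
    exact hm.not_gt hca hmc
  exact (Cardinal.aleph0_le_mk_iff.2 hinf.to_subtype).trans_lt (mk_Iio_lt_mk a)

theorem exists_forall_le_map_lt (hW : ℵ₀ < #W) (g : W → W) (a : W) :
    ∃ b, ∀ c ≤ a, g c < b := by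
  obtain ⟨d, hd⟩ := exists_forall_lt_of_mk_lt (ι := PUnit) (by simpa using one_lt_aleph0.trans hW)
    fun _ => a
  obtain ⟨b, hb⟩ := exists_forall_lt_of_mk_lt (mk_Iio_lt_mk d) fun c => g c
  exact ⟨b, fun c hc => hb ⟨c, hc.trans_lt (hd ⟨⟩)⟩⟩

theorem isClub_setOf_forall_lt_map_lt (hW : ℵ₀ < #W) (g : W → W) :
    IsClub {a | ∀ b < a, g b < a} where
  dirSupClosed s hs _ _ a ha b hb := by
    obtain ⟨c, hc, hbc⟩ := (lt_isLUB_iff ha).1 hb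
    exact (hs hc b hbc).trans_le (ha.1 hc)
  isCofinal a := by
    choose next hnext using exists_forall_le_map_lt hW g
    have hbdd : {b | ∀ n, next^[n] a < b}.Nonempty := by
      obtain ⟨b, hb⟩ := exists_forall_lt_of_mk_lt (ι := ULift ℕ) (by simpa using hW)
        fun n => next^[n.down] a
      exact ⟨b, fun n => hb ⟨n⟩⟩
    obtain ⟨b, hb, hmin⟩ := wellFounded_lt.has_min _ hbdd
    refine ⟨b, fun c hc => ?_, (hb 0).le⟩
    obtain ⟨n, hn⟩ : ∃ n, c ≤ next^[n] a := by
      by_contra! h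
      exact hmin c h hc
    calc g c < next (next^[n] a) := hnext _ c hn
      _ = next^[n + 1] a := (Function.iterate_succ_apply' next n a).symm
      _ < b := hb (n + 1)

theorem exists_isCofinal_fiber_of_isStationary (hW : ℵ₀ < #W) {T : Set W} (hT : IsStationary T)
    {g : W → W} (hg : ∀ a ∈ T, g a < a) : ∃ b, IsCofinal {a ∈ T | g a = b} := by
  by_contra! h
  choose bound hbound using fun b => not_isCofinal_iff.1 (h b)
  obtain ⟨a, haT, ha⟩ := hT (isClub_setOf_forall_lt_map_lt hW bound)
  exact lt_asymm (ha (g a) (hg a haT)) (hbound (g a) a ⟨haT, rfl⟩)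

variable [TopologicalSpace W] [OrderTopology W] {X : Type*} [TopologicalSpace X] {T : Set W}
  {h : W → X}

theorem exists_forall_Ioc_mem_of_isStationary (hT : IsStationary T)
    (hlim : ∀ a ∈ T, Order.IsSuccLimit a) (hh : ∀ a ∈ T, ContinuousWithinAt h (Set.Iic a) a)
    {N : W → Set X} (hN : ∀ a ∈ T, N a ∈ 𝓝 (h a)) :
    ∃ b, ∀ c, ∃ a ∈ T, c ≤ a ∧ ∀ d ∈ Set.Ioc b a, h d ∈ N a := by
  have hIoc : ∀ a ∈ T, ∃ b < a, ∀ d ∈ Set.Ioc b a, h d ∈ N a := fun a ha => by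
    obtain ⟨d, hd⟩ := not_isMin_iff.1 (hlim a ha).not_isMin
    exact (mem_nhdsLE_iff_exists_Ioc_subset' hd).1 (hh a ha (hN a ha))
  choose! g hg hgN using hIoc
  obtain ⟨a₀, ha₀⟩ := hT.nonempty
  obtain ⟨b, hb⟩ := exists_isCofinal_fiber_of_isStationary
    (aleph0_lt_mk_of_isSuccLimit (hlim a₀ ha₀)) hT hg
  refine ⟨b, fun c => ?_⟩
  obtain ⟨a, ⟨haT, rfl⟩, hca⟩ := hb c
  exact ⟨a, haT, hca, hgN a haT⟩

theorem exists_forall_gt_mem_iff_of_isClopen (hT : IsStationary T)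
    (hlim : ∀ a ∈ T, Order.IsSuccLimit a) (hh : ∀ a ∈ T, ContinuousWithinAt h (Set.Iic a) a)
    {K : Set X} (hK : IsClopen K) : ∃ b, ∀ c > b, ∀ d > b, (h c ∈ K ↔ h d ∈ K) := by
  have hN : ∀ a ∈ T, {x | x ∈ K ↔ h a ∈ K} ∈ 𝓝 (h a) := fun a _ => by
    by_cases ha : h a ∈ K
    · filter_upwards [hK.isOpen.mem_nhds ha] with x hx using iff_of_true hx ha
    · filter_upwards [hK.compl.isOpen.mem_nhds ha] with x hx using iff_of_false hx ha
  obtain ⟨b, hb⟩ := exists_forall_Ioc_mem_of_isStationary hT hlim hh hN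
  refine ⟨b, fun c hc d hd => ?_⟩
  obtain ⟨a, -, hcda, ha⟩ := hb (max c d)
  exact (ha c ⟨hc, le_of_max_le_left hcda⟩).trans (ha d ⟨hd, le_of_max_le_right hcda⟩).symm

theorem IsClopenDiagonalFamily.exists_forall_gt_eq {ι : Type u} {E : ι → X → X → Prop}
    (hE : IsClopenDiagonalFamily E) (hι : #ι < #W) (hT : IsStationary T)
    (hlim : ∀ a ∈ T, Order.IsSuccLimit a) (hh : ∀ a ∈ T, ContinuousWithinAt h (Set.Iic a) a) :
    ∃ b, ∀ c > b, ∀ d > b, h c = h d := by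
  have hbound : ∀ s, ∃ b, ∀ i, ∀ c > b, ∀ d > b, (E i (h s) (h c) ↔ E i (h s) (h d)) := by
    intro s
    choose g hg using fun i => exists_forall_gt_mem_iff_of_isClopen hT hlim hh
      (hE.isClopen i (h s))
    obtain ⟨b, hb⟩ := exists_forall_lt_of_mk_lt hι g
    exact ⟨b, fun i c hc d hd => hg i c ((hb i).trans hc) d ((hb i).trans hd)⟩
  choose bound hbound using hbound
  obtain ⟨a₀, ha₀⟩ := hT.nonempty
  obtain ⟨a, haT, ha⟩ := hT <|
    isClub_setOf_forall_lt_map_lt (aleph0_lt_mk_of_isSuccLimit (hlim a₀ ha₀)) bound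
  have heq : ∀ c > a, h a = h c := fun c hc => hE.forall_iff_eq.1 fun i => by
    by_contra hac
    have hN : {x | E i (h a) x} \ {x | E i (h c) x} ∈ 𝓝 (h a) :=
      ((hE.isClopen i (h a)).isOpen.sdiff (hE.isClopen i (h c)).isClosed).mem_nhds
        ⟨hE.forall_iff_eq.2 rfl i, mt hE.symm hac⟩
    obtain ⟨d, hd⟩ := not_isMin_iff.1 (hlim a haT).not_isMin
    obtain ⟨r, hra, hr⟩ := (mem_nhdsLE_iff_exists_Ioc_subset' hd).1 (hh a haT hN)
    obtain ⟨s, hsa, hrs⟩ := (hlim a haT).lt_iff_exists_lt.1 hra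
    obtain ⟨hsa', hsc⟩ := hr ⟨hrs, hsa.le⟩
    exact hsc (hE.symm ((hbound s i a (ha s hsa) c ((ha s hsa).trans hc)).1 (hE.symm hsa')))
  exact ⟨a, fun c hc d hd => (heq c hc).symm.trans (heq d hd)⟩

theorem IsOpenTournament.exists_forall_gt_eq {R : X × X → X × X → Prop}
    (hR : IsOpenTournament R) (hT : IsStationary T)
    (hlim : ∀ a ∈ T, Order.IsSuccLimit a) (hh : ∀ a ∈ T, ContinuousWithinAt h (Set.Iic a) a) :
    ∃ b, ∀ c > b, ∀ d > b, h c = h d := by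
  -- Either fewer than `#W` earlier values accumulate at some `h a`, which yields a clopen diagonal
  -- family of that size, or each `h a` has a neighbourhood avoiding all earlier values but itself.
  by_cases happroach : ∃ a ∈ T, h a ∈ closure (h '' {c | c < a ∧ h c ≠ h a})
  · obtain ⟨a, -, ha⟩ := happroach
    rw [Set.image_eq_range] at ha
    have hcard : #{c | c < a ∧ h c ≠ h a} < #W :=
      (Cardinal.mk_le_mk_of_subset fun c hc => hc.1).trans_lt (mk_Iio_lt_mk a)
    exact (hR.isClopenDiagonalFamily (fun c => c.2.2) ha).exists_forall_gt_eq hcard hT hlim hh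
  · push Not at happroach
    obtain ⟨b, hb⟩ := exists_forall_Ioc_mem_of_isStationary hT hlim hh
      fun a ha => isClosed_closure.isOpen_compl.mem_nhds (happroach a ha)
    have heq : ∀ c > b, ∀ a, c ≤ a → (∀ d ∈ Set.Ioc b a,
        h d ∈ (closure (h '' {c | c < a ∧ h c ≠ h a}))ᶜ) → h c = h a := by
      intro c hc a hca ha
      by_contra hne
      exact ha c ⟨hc, hca⟩ <| subset_closure
        ⟨c, ⟨hca.lt_of_ne fun h' => hne (congrArg h h'), hne⟩, rfl⟩
    refine ⟨b, fun c hc d hd => ?_⟩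
    obtain ⟨a, -, hcda, ha⟩ := hb (max c d)
    exact (heq c hc a (le_of_max_le_left hcda) ha).trans
      (heq d hd a (le_of_max_le_right hcda) ha).symm

end Stationary

section LocallyFinite

variable {α : Type*} [TopologicalSpace α]

theorem locallyFinite_prod {κ ι : Type*} {P : κ → Set α} {Q : κ → ι → Set α}
    (hP : LocallyFinite P) (hQ : ∀ k, LocallyFinite (Q k)) (hQP : ∀ k i, Q k i ⊆ P k) :
    LocallyFinite fun p : κ × ι => Q p.1 p.2 := by
  intro x
  obtain ⟨N, hN, hNfin⟩ := hP x
  choose M hM hMfin using fun k => hQ k x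
  refine ⟨N ∩ ⋂ k ∈ {k | (P k ∩ N).Nonempty}, M k,
    Filter.inter_mem hN ((Filter.biInter_mem hNfin).2 fun k _ => hM k), ?_⟩
  refine (hNfin.biUnion fun k _ => (hMfin k).image (Prod.mk k)).subset ?_
  rintro ⟨k, i⟩ ⟨y, hyQ, hyN, hyM⟩
  have hk : (P k ∩ N).Nonempty := ⟨y, hQP k i hyQ, hyN⟩
  exact Set.mem_biUnion hk ⟨i, ⟨y, hyQ, Set.mem_iInter₂.1 hyM k hk⟩, rfl⟩

theorem locallyFinite_inter_of_pairwise_disjoint {ι : Type*} {V : ι → Set α}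
    (hV : ∀ i, IsOpen (V i)) (hdisj : Pairwise fun i j => Disjoint (V i) (V j)) {P : Set α}
    (hP : closure P ⊆ ⋃ i, V i) : LocallyFinite fun i => V i ∩ P := by
  intro x
  by_cases hx : x ∈ closure P
  · obtain ⟨i, hi⟩ := Set.mem_iUnion.1 (hP hx)
    refine ⟨V i, (hV i).mem_nhds hi, (Set.finite_singleton i).subset ?_⟩
    rintro j ⟨y, ⟨hyj, -⟩, hyi⟩
    by_contra hji
    exact Set.disjoint_left.1 (hdisj hji) hyj hyi
  · refine ⟨(closure P)ᶜ, isClosed_closure.isOpen_compl.mem_nhds hx, Set.finite_empty.subset ?_⟩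
    rintro j ⟨y, ⟨-, hyP⟩, hy⟩
    exact hy (subset_closure hyP)

theorem exists_locallyFinite_closure_subset [NormalSpace α] {O G : ℕ → Set α}
    (hO : ∀ n, IsOpen (O n)) (hG : ∀ n, IsClosed (G n)) (hGO : ∀ n, G n ⊆ O n)
    (hcov : ∀ x, ∃ n, x ∈ G n) :
    ∃ P : ℕ → Set α, (∀ n, IsOpen (P n)) ∧ LocallyFinite P ∧ (∀ n, closure (P n) ⊆ O n) ∧
      ∀ x, ∃ n, x ∈ P n := by
  choose H hHo hGH hHO using fun n => normal_exists_closure_subset (hG n) (hO n) (hGO n)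
  choose K hKo hHK hKO using fun n => normal_exists_closure_subset isClosed_closure (hO n) (hHO n)
  refine ⟨fun n => K n \ ⋃ m ∈ Set.Iio n, closure (H m), fun n => ?_, fun x => ?_, fun n => ?_,
    fun x => ?_⟩
  · exact (hKo n).sdiff ((Set.finite_Iio n).isClosed_biUnion fun _ _ => isClosed_closure)
  · obtain ⟨n, hn⟩ := hcov x
    refine ⟨H n, (hHo n).mem_nhds (hGH n hn), (Set.finite_Iic n).subset ?_⟩
    rintro m ⟨y, ⟨-, hy⟩, hyH⟩
    by_contra hnm
    exact hy (Set.mem_biUnion (Set.mem_Iio.2 (not_le.1 hnm)) (subset_closure hyH))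
  · exact (closure_mono Set.sdiff_subset).trans (hKO n)
  · have hex : ∃ n, x ∈ closure (H n) :=
      (hcov x).imp fun n hn => subset_closure (hGH n hn)
    classical
    refine ⟨Nat.find hex, hHK _ (Nat.find_spec hex), ?_⟩
    simpa only [Set.mem_iUnion, Set.mem_Iio, not_exists] using fun m hm => Nat.find_min hex hm

end LocallyFinite

section Michael

/-- `F` is a precise refinement of the cover `U` by closed sets every subfamily of which has closed
union. -/
structure IsClosurePreservingRefinement {ι α : Type*} [TopologicalSpace α] (F U : ι → Set α) :
    Prop where
  isClosed_biUnion : ∀ J : Set ι, IsClosed (⋃ i ∈ J, F i)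
  subset : ∀ i, F i ⊆ U i
  exists_mem : ∀ x, ∃ i, x ∈ F i

namespace IsClosurePreservingRefinement

variable {ι α : Type*} [TopologicalSpace α] {F U : ι → Set α}

theorem isClosed (hF : IsClosurePreservingRefinement F U) (i : ι) : IsClosed (F i) := by
  simpa using hF.isClosed_biUnion {i}

theorem comp (hF : IsClosurePreservingRefinement F U) {κ : Type*} {r : κ → ι}
    (hr : r.Surjective) : IsClosurePreservingRefinement (F ∘ r) (U ∘ r) where
  isClosed_biUnion J := by
    simpa only [Set.biUnion_image, Function.comp_apply] using hF.isClosed_biUnion (r '' J)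
  subset k := hF.subset (r k)
  exists_mem x := by simpa only [Function.comp_apply, hr.exists] using hF.exists_mem x

end IsClosurePreservingRefinement

/-- Michael's refinement property: every open cover has a closure-preserving closed refinement. -/
def HasClosurePreservingRefinements (α : Type u) [TopologicalSpace α] : Prop :=
  ∀ ⦃ι : Type u⦄ (U : ι → Set α), (∀ i, IsOpen (U i)) → (∀ x, ∃ i, x ∈ U i) →
    ∃ F, IsClosurePreservingRefinement F U

theorem exists_existsUnique_mem_of_disjoint {ι α : Type*} [LinearOrder ι] [WellFoundedLT ι]
    {F : ℕ → ι → Set α} (hcov : ∀ n x, ∃ i, x ∈ F n i)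
    (hdisj : ∀ n i, ∀ j < i, Disjoint (F (n + 1) i) (F n j)) (x : α) : ∃ n, ∃! i, x ∈ F n i := by
  obtain ⟨i, ⟨n, hn⟩, hmin⟩ := wellFounded_lt.has_min {i | ∃ n, x ∈ F n i}
    ((hcov 0 x).imp fun i hi => ⟨0, hi⟩)
  have huniq : ∀ j, x ∈ F (n + 1) j → j = i := fun j hj => by
    refine (not_lt.1 (hmin j ⟨n + 1, hj⟩)).eq_of_not_lt' fun hij => ?_
    exact Set.disjoint_left.1 (hdisj n j i hij) hj hn
  obtain ⟨j, hj⟩ := hcov (n + 1) x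
  exact ⟨n + 1, i, huniq j hj ▸ hj, huniq⟩

namespace HasClosurePreservingRefinements

variable {α : Type u} [TopologicalSpace α]

theorem exists_refinement (hα : HasClosurePreservingRefinements α) {ι : Type*} {U : ι → Set α}
    (hU : ∀ i, IsOpen (U i)) (hcov : ∀ x, ∃ i, x ∈ U i) :
    ∃ F, IsClosurePreservingRefinement F U := by
  obtain ⟨F, hF⟩ := hα ((↑) : Set.range U → Set α) (by simpa using hU) (by simpa using hcov)
  exact ⟨_, hF.comp Set.rangeFactorization_surjective⟩

theorem normalSpace (hα : HasClosurePreservingRefinements α) : NormalSpace α := by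
  refine ⟨fun s t hs ht hst => ?_⟩
  obtain ⟨F, hF⟩ := hα.exists_refinement (U := fun b : Bool => bif b then sᶜ else tᶜ)
    (by simp [hs, ht]) fun x => by
      by_contra! h
      exact Set.disjoint_left.1 hst (not_not.1 (h true)) (not_not.1 (h false))
  refine ⟨(F true)ᶜ, (F false)ᶜ, (hF.isClosed _).isOpen_compl, (hF.isClosed _).isOpen_compl,
    fun x hx h => hF.subset _ h hx, fun x hx h => hF.subset _ h hx, ?_⟩
  rw [Set.disjoint_left]
  intro x ht hf
  obtain ⟨_ | _, hx⟩ := hF.exists_mem x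
  exacts [hf hx, ht hx]

theorem exists_next (hα : HasClosurePreservingRefinements α) {ι : Type*} [LinearOrder ι]
    [WellFoundedLT ι] {F U : ι → Set α} (hU : ∀ i, IsOpen (U i))
    (hF : IsClosurePreservingRefinement F U) :
    ∃ G, IsClosurePreservingRefinement G U ∧ ∀ i, ∀ j < i, Disjoint (G i) (F j) := by
  obtain ⟨G, hG⟩ := hα.exists_refinement (U := fun i => U i \ ⋃ j ∈ Set.Iio i, F j)
    (fun i => (hU i).sdiff (hF.isClosed_biUnion _)) fun x => by
      obtain ⟨i, hi, hmin⟩ := wellFounded_lt.has_min {i | x ∈ F i} (hF.exists_mem x)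
      refine ⟨i, hF.subset i hi, ?_⟩
      simp only [Set.mem_iUnion, Set.mem_Iio, not_exists]
      exact fun j hj hx => hmin j hx hj
  exact ⟨G, ⟨hG.isClosed_biUnion, fun i => (hG.subset i).trans Set.sdiff_subset, hG.exists_mem⟩,
    fun i j hj => Set.disjoint_left.2 fun x hxG hxF => (hG.subset i hxG).2 (Set.mem_biUnion hj hxF)⟩

theorem exists_seq (hα : HasClosurePreservingRefinements α) {ι : Type*} [LinearOrder ι]
    [WellFoundedLT ι] {U : ι → Set α} (hU : ∀ i, IsOpen (U i)) (hcov : ∀ x, ∃ i, x ∈ U i) :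
    ∃ F : ℕ → ι → Set α, (∀ n, IsClosurePreservingRefinement (F n) U) ∧
      ∀ n i, ∀ j < i, Disjoint (F (n + 1) i) (F n j) := by
  obtain ⟨F₀, hF₀⟩ := hα.exists_refinement hU hcov
  choose! next hnext hdisj using fun F (hF : IsClosurePreservingRefinement F U) =>
    hα.exists_next hU hF
  have hF : ∀ n, IsClosurePreservingRefinement (next^[n] F₀) U :=
    Function.Iterate.rec _ hF₀ hnext
  refine ⟨fun n => next^[n] F₀, hF, fun n => ?_⟩
  simpa only [Function.iterate_succ_apply'] using hdisj _ (hF n)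

theorem exists_sigma_disjoint_refinement (hα : HasClosurePreservingRefinements α) {ι : Type*}
    {U : ι → Set α} (hU : ∀ i, IsOpen (U i)) (hcov : ∀ x, ∃ i, x ∈ U i) :
    ∃ V : ℕ → ι → Set α, (∀ n i, IsOpen (V n i)) ∧ (∀ n i, V n i ⊆ U i) ∧
      (∀ n, Pairwise fun i j => Disjoint (V n i) (V n j)) ∧ ∀ x, ∃ n i, x ∈ V n i := by
  obtain ⟨_, _⟩ := exists_wellFoundedLT ι
  obtain ⟨F, hF, hdisj⟩ := hα.exists_seq hU hcov
  let V : ℕ → ι → Set α := fun n i => (⋃ j ∈ ({i}ᶜ : Set ι), F n j)ᶜ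
  have hmem : ∀ {n i x}, x ∈ V n i ↔ ∀ j, x ∈ F n j → j = i := by simp [V, not_imp_not]
  have hsub : ∀ {n i x}, x ∈ V n i → x ∈ F n i := by
    intro n i x hx
    obtain ⟨j, hj⟩ := (hF n).exists_mem x
    exact hmem.1 hx j hj ▸ hj
  refine ⟨V, fun n i => ((hF n).isClosed_biUnion _).isOpen_compl,
    fun n i x hx => (hF n).subset i (hsub hx), fun n i j hij => Set.disjoint_left.2 fun x hi hj =>
      hij (hmem.1 hj i (hsub hi)), fun x => ?_⟩
  obtain ⟨n, i, -, hi⟩ := exists_existsUnique_mem_of_disjoint (fun n => (hF n).exists_mem) hdisj x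
  exact ⟨n, i, hmem.2 hi⟩

theorem paracompactSpace (hα : HasClosurePreservingRefinements α) : ParacompactSpace α := by
  have := hα.normalSpace
  refine ⟨fun ι U hU hcov => ?_⟩
  obtain ⟨V, hVo, hVU, hVdisj, hVcov⟩ := hα.exists_sigma_disjoint_refinement hU
    (Set.iUnion_eq_univ_iff.1 hcov)
  have hO : ∀ n, IsOpen (⋃ i, V n i) := fun n => isOpen_iUnion (hVo n)
  obtain ⟨G, hG⟩ := hα.exists_refinement hO (by simpa only [Set.mem_iUnion] using hVcov)
  obtain ⟨P, hPo, hPfin, hPV, hPcov⟩ :=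
    exists_locallyFinite_closure_subset hO hG.isClosed hG.subset hG.exists_mem
  refine ⟨ℕ × ι, fun p => V p.1 p.2 ∩ P p.1, fun p => (hVo _ _).inter (hPo _),
    Set.iUnion_eq_univ_iff.2 fun x => ?_,
    locallyFinite_prod hPfin
      (fun n => locallyFinite_inter_of_pairwise_disjoint (hVo n) (hVdisj n) (hPV n))
      fun n i => Set.inter_subset_right,
    fun p => ⟨p.2, Set.inter_subset_left.trans (hVU p.1 p.2)⟩⟩
  obtain ⟨n, hn⟩ := hPcov x
  obtain ⟨i, hi⟩ := Set.mem_iUnion.1 (hPV n (subset_closure hn))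
  exact ⟨(n, i), hi, hn⟩

end HasClosurePreservingRefinements

end Michael

theorem exists_isCofinal_isRegularCardinalOrder (α : Type*) [LinearOrder α] :
    ∃ s : Set α, IsCofinal s ∧ ∃ _ : WellFoundedLT s, IsRegularCardinalOrder s := by
  obtain ⟨s, hs, hcard⟩ := Order.exists_cof_eq α
  obtain ⟨r, hr, hord⟩ := Cardinal.exists_ord_eq s
  let t : Set α := (↑) '' {a : s | ∀ b, r b a → b < a}
  have ht : IsCofinal t := hs.trans (isCofinal_setOfPred_imp_lt r)
  have hts : ∀ x : t, ∃ a : s, (∀ b, r b a → b < a) ∧ (a : α) = x := fun x => x.2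
  choose g hg hgx using hts
  let e : ((· < ·) : t → t → Prop) ↪r r := .ofMonotone g fun x y hxy => by
    have hlt : g x < g y := by rwa [← Subtype.coe_lt_coe, hgx, hgx]
    exact (trichotomous_of r _ _).resolve_right fun h =>
      h.elim hlt.ne fun hr => hlt.not_gt (hg x _ hr)
  have hwf : WellFoundedLT t := ⟨e.wellFounded hr.wf⟩
  refine ⟨t, ht, hwf, ⟨?_⟩⟩
  calc Ordinal.type ((· < ·) : t → t → Prop) ≤ Ordinal.type r := e.ordinal_type_le
    _ = (Order.cof t).ord := by rw [← hord, hcard, Order.cof_eq_of_isCofinal ht]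

/-- A generalized ordered space: rays are open, and the order-convex neighbourhoods of each point
form a neighbourhood base. These are the suborderable spaces with a compatible order fixed. -/
class GeneralizedOrderedSpace (Z : Type*) [LinearOrder Z] [TopologicalSpace Z] : Prop
    extends OrderClosedTopology Z where
  exists_ordConnected_subset (z : Z) : ∀ U ∈ 𝓝 z, ∃ N ∈ 𝓝 z, N.OrdConnected ∧ N ⊆ U

instance GeneralizedOrderedSpace.orderDual {Z : Type*} [LinearOrder Z] [TopologicalSpace Z]
    [GeneralizedOrderedSpace Z] : GeneralizedOrderedSpace Zᵒᵈ where
  exists_ordConnected_subset z U hU := by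
    obtain ⟨N, hN, hNc, hNU⟩ :=
      GeneralizedOrderedSpace.exists_ordConnected_subset (OrderDual.ofDual z) U hU
    exact ⟨N, hN, hNc.dual, hNU⟩

namespace SuborderableSpace

variable {Z : Type v} [TopologicalSpace Z]

theorem exists_generalizedOrderedSpace (hZ : SuborderableSpace.{v, w} Z) :
    ∃ _ : LinearOrder Z, GeneralizedOrderedSpace Z := by
  obtain ⟨L, _, ⟨_, _⟩, e, he⟩ := hZ
  let _ : LinearOrder Z := LinearOrder.lift' e he.injective
  have hmono : Monotone e := fun _ _ h => h
  have hclosed : IsClosed {p : Z × Z | e p.1 ≤ e p.2} :=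
    isClosed_le (he.continuous.comp continuous_fst) (he.continuous.comp continuous_snd)
  have : OrderClosedTopology Z := ⟨hclosed⟩
  refine ⟨inferInstance, ⟨fun z U hU => ?_⟩⟩
  obtain ⟨O, hO, hOU⟩ := Filter.mem_comap.1 (he.nhds_eq_comap z ▸ hU)
  exact ⟨e ⁻¹' Set.ordConnectedComponent O (e z),
    he.continuous.continuousAt.preimage_mem_nhds (Set.ordConnectedComponent_mem_nhds.2 hO),
    Set.OrdConnected.preimage_mono inferInstance hmono,
    (Set.preimage_mono Set.ordConnectedComponent_subset).trans hOU⟩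

theorem subtype (hZ : SuborderableSpace.{v, w} Z) (s : Set Z) : SuborderableSpace.{v, w} s := by
  obtain ⟨L, _, hL, e, he⟩ := hZ
  exact ⟨L, _, hL, e ∘ Subtype.val, he.comp Topology.IsEmbedding.subtypeVal⟩

end SuborderableSpace

/-- `D` is covered by a locally finite family of closed sets which refines `V` precisely. -/
def LocallyFinitelyCovered {ι Z : Type*} [TopologicalSpace Z] (V : ι → Set Z) (D : Set Z) : Prop :=
  ∃ F : ι → Set Z, LocallyFinite F ∧ (∀ i, IsClosed (F i)) ∧ (∀ i, F i ⊆ V i) ∧ D ⊆ ⋃ i, F i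

namespace LocallyFinitelyCovered

variable {ι κ Z : Type*} [TopologicalSpace Z] {V : ι → Set Z} {D E : Set Z}

theorem mono (hE : LocallyFinitelyCovered V E) (h : D ⊆ E) : LocallyFinitelyCovered V D := by
  obtain ⟨F, hF, hFc, hFV, hEF⟩ := hE
  exact ⟨F, hF, hFc, hFV, h.trans hEF⟩

theorem of_refinement {F : κ → Set Z} (hF : LocallyFinite F) (hFc : ∀ k, IsClosed (F k))
    (r : κ → ι) (hr : ∀ k, F k ⊆ V (r k)) : LocallyFinitelyCovered V (⋃ k, F k) := by
  refine ⟨fun i => ⋃ k : r ⁻¹' {i}, F k, fun z => ?_, fun i => ?_, fun i => ?_, fun z hz => ?_⟩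
  · obtain ⟨N, hN, hfin⟩ := hF z
    refine ⟨N, hN, (hfin.image r).subset ?_⟩
    rintro i ⟨x, hx, hxN⟩
    obtain ⟨⟨k, hk⟩, hxk⟩ := Set.mem_iUnion.1 hx
    exact ⟨k, ⟨x, hxk, hxN⟩, hk⟩
  · exact (hF.comp_injective Subtype.val_injective).isClosed_iUnion fun k => hFc k
  · exact Set.iUnion_subset fun ⟨k, hk⟩ => hk ▸ hr k
  · obtain ⟨k, hk⟩ := Set.mem_iUnion.1 hz
    exact Set.mem_iUnion.2 ⟨r k, Set.mem_iUnion.2 ⟨⟨k, rfl⟩, hk⟩⟩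

theorem of_isClosed (hD : IsClosed D) {i : ι} (h : D ⊆ V i) : LocallyFinitelyCovered V D :=
  (of_refinement (F := fun _ : Unit => D) (locallyFinite_of_finite _) (fun _ => hD) (fun _ => i)
    fun _ => h).mono (Set.iUnion_const D).ge

theorem union (hD : LocallyFinitelyCovered V D) (hE : LocallyFinitelyCovered V E) :
    LocallyFinitelyCovered V (D ∪ E) := by
  obtain ⟨F, hF, hFc, hFV, hDF⟩ := hD
  obtain ⟨G, hG, hGc, hGV, hEG⟩ := hE
  refine (of_refinement (hF.sumElim hG) (Sum.forall.2 ⟨hFc, hGc⟩) (Sum.elim id id)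
    (Sum.forall.2 ⟨hFV, hGV⟩)).mono ?_
  rw [Set.iUnion_sum]
  exact Set.union_subset_union hDF hEG

theorem iUnion {P : κ → Set Z} (hP : LocallyFinite P) (hPc : ∀ k, IsClosed (P k))
    (h : ∀ k, LocallyFinitelyCovered V (P k)) : LocallyFinitelyCovered V (⋃ k, P k) := by
  choose F hF hFc hFV hPF using h
  refine (of_refinement (F := fun p : κ × ι => P p.1 ∩ F p.1 p.2)
    (locallyFinite_prod hP (fun k => (hF k).subset fun i => Set.inter_subset_right)
      fun k i => Set.inter_subset_left)
    (fun p => (hPc p.1).inter (hFc p.1 p.2)) Prod.snd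
    fun p => Set.inter_subset_right.trans (hFV p.1 p.2)).mono ?_
  rintro z hz
  obtain ⟨k, hk⟩ := Set.mem_iUnion.1 hz
  obtain ⟨i, hi⟩ := Set.mem_iUnion.1 (hPF k hk)
  exact Set.mem_iUnion.2 ⟨(k, i), hk, hi⟩

theorem exists_isClosurePreservingRefinement {Y : Type*} [TopologicalSpace Y] {f : Z → Y}
    (hfc : IsClosedMap f) (hfs : f.Surjective) {U : ι → Set Y}
    (h : LocallyFinitelyCovered (fun i => f ⁻¹' U i) Set.univ) :
    ∃ F, IsClosurePreservingRefinement F U := by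
  obtain ⟨F, hF, hFc, hFU, hcov⟩ := h
  refine ⟨fun i => f '' F i, fun J => ?_, fun i => Set.image_subset_iff.2 (hFU i), fun y => ?_⟩
  · rw [← Set.image_iUnion₂, Set.biUnion_eq_iUnion]
    exact hfc _ ((hF.comp_injective Subtype.val_injective).isClosed_iUnion fun i => hFc i)
  · obtain ⟨z, rfl⟩ := hfs y
    obtain ⟨i, hi⟩ := Set.mem_iUnion.1 (hcov (Set.mem_univ z))
    exact ⟨i, Set.mem_image_of_mem f hi⟩

end LocallyFinitelyCovered

section Tails

variable {Z W : Type*} [LinearOrder Z] [LinearOrder W]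

/-- The part of `C` below the initial segment `(y v)_{v < w}` of the sequence `y`. For a limit `w`
and `y` in a closed `C`, it is closed exactly when that segment has no limit in `C`. -/
def initialPart (C : Set Z) (y : W → Z) (w : W) : Set Z :=
  {z ∈ C | ∃ v < w, z < y v}

variable {C : Set Z} {y : W → Z} {c : Z}

theorem initialPart_comp_of_isNormal (hy : StrictMono y) {g : W → W} (hg : Order.IsNormal g) {w : W}
    (hw : Order.IsSuccLimit w) : initialPart C (y ∘ g) w = initialPart C y (g w) := by
  ext z
  refine and_congr_right fun _ => ⟨fun ⟨v, hv, hz⟩ => ⟨g v, hg.strictMono hv, hz⟩, ?_⟩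
  rintro ⟨v, hv, hz⟩
  obtain ⟨u, hu, hvu⟩ := (hg.lt_iff_exists_lt hw).1 hv
  exact ⟨u, hu, hz.trans (hy hvu)⟩

variable [TopologicalSpace Z] [OrderClosedTopology Z] {ι : Type*} {V : ι → Set Z}

theorem isOpen_initialPart (hC : IsOpen C) (w : W) : IsOpen (initialPart C y w) := by
  have heq : initialPart C y w = C ∩ ⋃ v ∈ Set.Iio w, Set.Iio (y v) := by
    ext z
    simp [initialPart]
  rw [heq]
  exact hC.inter (isOpen_biUnion fun _ _ => isOpen_Iio)

theorem exists_mem_nhds_forall_lt (hy : StrictMono y) {w : W}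
    (hw : Order.IsSuccPrelimit w → IsClosed (initialPart C y w)) {z : Z} (hz : ∀ v < w, y v < z) :
    ∃ N ∈ 𝓝 z, ∀ x ∈ N ∩ C, ∀ v < w, y v < x := by
  by_cases hlim : Order.IsSuccPrelimit w
  · refine ⟨(initialPart C y w)ᶜ, (hw hlim).isOpen_compl.mem_nhds ?_, ?_⟩
    · rintro ⟨-, v, hv, hzv⟩
      exact lt_asymm hzv (hz v hv)
    · rintro x ⟨hx, hxC⟩ v hv
      obtain ⟨u, hu, hvu⟩ := hlim.lt_iff_exists_lt.1 hv
      exact (hy hvu).trans_le (not_lt.1 fun h => hx ⟨hxC, u, hu, h⟩)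
  · obtain ⟨u, hu⟩ := Order.not_isSuccPrelimit_iff.1 hlim
    exact ⟨Set.Ioi (y u), isOpen_Ioi.mem_nhds (hz u hu.lt), fun x hx v hv =>
      (hy.monotone (hu.le_of_lt hv)).trans_lt hx.1⟩

theorem locallyFinite_Icc_sdiff_initialPart [WellFoundedLT W] (hC : IsClopen C) (hy : StrictMono y)
    (hcof : ∀ z ∈ C, ∃ w, z < y w)
    (hclosed : ∀ w, Order.IsSuccPrelimit w → IsClosed (initialPart C y w)) :
    LocallyFinite fun w => (C ∩ Set.Icc c (y w)) \ initialPart C y w := by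
  intro z
  by_cases hz : z ∈ C
  · obtain ⟨w₁, hw₁, hmin₁⟩ := wellFounded_lt.has_min {w | z < y w} (hcof z hz)
    obtain ⟨w₀, hw₀, hmin₀⟩ := wellFounded_lt.has_min {w | z ≤ y w} ⟨w₁, hw₁.le⟩
    obtain ⟨N, hN, hNy⟩ := exists_mem_nhds_forall_lt hy (hclosed w₀)
      fun v hv => not_le.1 fun h => hmin₀ v h hv
    refine ⟨N ∩ Set.Iio (y w₁), Filter.inter_mem hN (isOpen_Iio.mem_nhds hw₁),
      (Set.toFinite {w₀, w₁}).subset ?_⟩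
    rintro w ⟨x, ⟨⟨hxC, -, hxw⟩, hx⟩, hxN, hxw₁⟩
    have hw₀w : w₀ ≤ w := not_lt.1 fun h => hxw.not_gt (hNy x ⟨hxN, hxC⟩ w h)
    have hww₁ : w ≤ w₁ := not_lt.1 fun h => hx ⟨hxC, w₁, h, hxw₁⟩
    by_contra! hne
    obtain ⟨hne₀, hne₁⟩ := not_or.1 hne
    exact hmin₁ w (hw₀.trans_lt (hy (hw₀w.lt_of_ne' hne₀))) (hww₁.lt_of_ne hne₁)
  · exact ⟨Cᶜ, hC.compl.isOpen.mem_nhds hz, Set.finite_empty.subset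
      fun w ⟨x, hx, hxC⟩ => hxC hx.1.1⟩

namespace LocallyFinitelyCovered

theorem inter_Ici_of_isClosed_initialPart [WellFoundedLT W] (hC : IsClopen C) (hy : StrictMono y)
    (hcof : ∀ z ∈ C, ∃ w, z < y w)
    (hclosed : ∀ w, Order.IsSuccPrelimit w → IsClosed (initialPart C y w))
    (hV : ∀ w, LocallyFinitelyCovered V (Set.Icc c (y w))) :
    LocallyFinitelyCovered V (C ∩ Set.Ici c) := by
  refine (LocallyFinitelyCovered.iUnion (locallyFinite_Icc_sdiff_initialPart hC hy hcof hclosed)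
    (fun w => (hC.isClosed.inter isClosed_Icc).sdiff (isOpen_initialPart hC.isOpen w))
    fun w => (hV w).mono fun z hz => hz.1.2).mono ?_
  rintro z ⟨hz, hcz⟩
  obtain ⟨w, hw, hmin⟩ := wellFounded_lt.has_min {w | z < y w} (hcof z hz)
  exact Set.mem_iUnion.2 ⟨w, ⟨hz, hcz, hw.le⟩, fun ⟨_, v, hv, hzv⟩ => hmin v hzv hv⟩

theorem inter_Ici_of_not_isStationary [WellFoundedLT W] [IsRegularCardinalOrder W]
    (hC : IsClopen C) (hy : StrictMono y) (hcof : ∀ z ∈ C, ∃ w, z < y w)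
    (hT : ¬ IsStationary {w | Order.IsSuccLimit w ∧ ¬ IsClosed (initialPart C y w)})
    (hV : ∀ w, LocallyFinitelyCovered V (Set.Icc c (y w))) :
    LocallyFinitelyCovered V (C ∩ Set.Ici c) := by
  obtain ⟨D, hD, hTD⟩ := not_isStationary_iff.1 hT
  let g : W → W := (↑) ∘ Order.enum D hD.isCofinal
  have hg : Order.IsNormal g := hD.isNormal_enum
  refine inter_Ici_of_isClosed_initialPart (y := y ∘ g) hC (hy.comp hg.strictMono)
    (fun z hz => ?_) (fun w hw => ?_) fun w => hV (g w)
  · obtain ⟨w, hw⟩ := hcof z hz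
    exact ⟨w, hw.trans_le (hy.monotone hg.strictMono.le_apply)⟩
  · by_cases hmin : IsMin w
    · have hempty : initialPart C (y ∘ g) w = ∅ :=
        Set.eq_empty_of_forall_notMem fun z ⟨_, v, hv, _⟩ => hmin.not_lt hv
      exact hempty ▸ isClosed_empty
    · have hlim : Order.IsSuccLimit w := ⟨hmin, hw⟩
      rw [initialPart_comp_of_isNormal hy hg hlim]
      by_contra hcl
      exact Set.disjoint_right.1 hTD (Order.enum D hD.isCofinal w).2
        ⟨hg.map_isSuccLimit hlim, hcl⟩

end LocallyFinitelyCovered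

end Tails

section GeneralizedOrderedSpace

variable {Z : Type v} [LinearOrder Z] [TopologicalSpace Z] [GeneralizedOrderedSpace Z] {C : Set Z}

theorem exists_continuousWithinAt_of_not_isClosed_initialPart {W : Type*} [LinearOrder W]
    [TopologicalSpace W] [OrderTopology W] {y : W → Z} (hC : IsClosed C) (hy : StrictMono y) :
    ∃ l : W → Z, (∀ v w, v < w → y v ≤ l w) ∧ (∀ w, l w ≤ y w) ∧
      ∀ w, ¬ IsClosed (initialPart C y w) → ContinuousWithinAt l (Set.Iic w) w := by
  have hl : ∀ w, ∃ z, (∀ v < w, y v ≤ z) ∧ z ≤ y w ∧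
      (¬ IsClosed (initialPart C y w) → z ∈ closure (initialPart C y w)) := fun w => by
    by_cases hw : IsClosed (initialPart C y w)
    · exact ⟨y w, fun v hv => (hy hv).le, le_rfl, fun h => (h hw).elim⟩
    · obtain ⟨z, hz, hz'⟩ := Set.not_subset.1 (mt isClosed_of_closure_subset hw)
      have hzC : z ∈ C := closure_minimal (fun x hx => hx.1) hC hz
      have hsub : initialPart C y w ⊆ Set.Iic (y w) :=
        fun x ⟨_, v, hv, hxv⟩ => (hxv.trans (hy hv)).le
      exact ⟨z, fun v hv => not_lt.1 fun h => hz' ⟨hzC, v, hv, h⟩,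
        closure_minimal hsub isClosed_Iic hz, fun _ => hz⟩
  choose l hyl hly hlcl using hl
  have hmono : Monotone l := monotone_iff_forall_lt.2 fun v w hvw => (hly v).trans (hyl w v hvw)
  refine ⟨l, fun v w hvw => hyl w v hvw, hly, fun w hw U hU => ?_⟩
  obtain ⟨N, hN, hNc, hNU⟩ := GeneralizedOrderedSpace.exists_ordConnected_subset (l w) U hU
  obtain ⟨x, hxN, -, v, hv, hxv⟩ := mem_closure_iff_nhds.1 (hlcl w hw) N hN
  refine Filter.mem_map.2 ?_
  filter_upwards [Ioc_mem_nhdsLE hv] with u hu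
  exact hNU (hNc.out hxN (mem_of_mem_nhds hN) ⟨hxv.le.trans (hyl u v hu.1), hmono hu.2⟩)

variable {X : Type*} [TopologicalSpace X] {f : Z → X} {ι : Type*} {U : ι → Set X}
  {R : X × X → X × X → Prop} {c : Z}

theorem IsOpenTournament.exists_inter_Ici_subset_preimage (hR : IsOpenTournament R)
    (hf : Continuous f) (hU : ∀ i, IsOpen (U i)) (hcov : ∀ x, ∃ i, x ∈ U i)
    {W : Type*} [LinearOrder W] [WellFoundedLT W] [IsRegularCardinalOrder W] {y : W → Z}
    (hC : IsClosed C) (hy : StrictMono y) (hyC : ∀ w, y w ∈ C) (hcof : ∀ z ∈ C, ∃ w, z < y w)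
    (hT : IsStationary {w | Order.IsSuccLimit w ∧ ¬ IsClosed (initialPart C y w)}) :
    ∃ w i, C ∩ Set.Ici (y w) ⊆ f ⁻¹' U i := by
  let _ : TopologicalSpace W := Preorder.topology W
  have : OrderTopology W := ⟨rfl⟩
  have hgt : ∀ v, ∃ w, v < w := fun v => (hcof _ (hyC v)).imp fun w => hy.lt_iff_lt.1
  obtain ⟨l, hyl, hly, hlcont⟩ := exists_continuousWithinAt_of_not_isClosed_initialPart hC hy
  choose j hj using hcov
  choose N hN hNc hNU using fun a => GeneralizedOrderedSpace.exists_ordConnected_subset (l a)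
    (f ⁻¹' U (j (f (l a)))) (((hU _).preimage hf).mem_nhds (hj _))
  obtain ⟨b, hb⟩ := hR.exists_forall_gt_eq hT (fun a ha => ha.1)
    fun a ha => hf.continuousAt.comp_continuousWithinAt (hlcont a ha.2)
  obtain ⟨d, hd⟩ := exists_forall_Ioc_mem_of_isStationary hT (fun a ha => ha.1)
    (fun a ha => hlcont a ha.2) fun a _ => hN a
  obtain ⟨w, hw⟩ := hgt (max b d)
  refine ⟨w, j (f (l w)), fun z ⟨hzC, hwz⟩ => ?_⟩
  obtain ⟨v, hzv⟩ := hcof z hzC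
  obtain ⟨v', hvv'⟩ := hgt v
  obtain ⟨a, -, hv'a, ha⟩ := hd v'
  have hva : v < a := hvv'.trans_le hv'a
  have hwv : w < v := hy.lt_iff_lt.1 (lt_of_le_of_lt hwz hzv)
  have hwN : l w ∈ N a := ha w ⟨(le_max_right b d).trans_lt hw, (hwv.trans hva).le⟩
  have hbw : b < w := (le_max_left b d).trans_lt hw
  have hfl : f (l a) = f (l w) := hb a (hbw.trans (hwv.trans hva)) w hbw
  rw [← hfl]
  exact hNU a ((hNc a).out hwN (mem_of_mem_nhds (hN a))
    ⟨(hly w).trans hwz, hzv.le.trans (hyl v a hva)⟩)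

namespace LocallyFinitelyCovered

theorem inter_Ici (hR : IsOpenTournament R) (hf : Continuous f) (hU : ∀ i, IsOpen (U i))
    (hcov : ∀ x, ∃ i, x ∈ U i) (hC : IsClopen C)
    (hV : ∀ z ∈ C, LocallyFinitelyCovered (fun i => f ⁻¹' U i) (Set.Icc c z)) :
    LocallyFinitelyCovered (fun i => f ⁻¹' U i) (C ∩ Set.Ici c) := by
  by_cases hmax : ∃ m ∈ C, ∀ z ∈ C, z ≤ m
  · obtain ⟨m, hm, hmax⟩ := hmax
    exact (hV m hm).mono fun z hz => ⟨hz.2, hmax z hz.1⟩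
  push Not at hmax
  obtain ⟨W, hWcof, _, _⟩ := exists_isCofinal_isRegularCardinalOrder C
  let y : W → Z := fun w => w.1.1
  have hy : StrictMono y := fun _ _ h => h
  have hyC : ∀ w, y w ∈ C := fun w => w.1.2
  have hcof : ∀ z ∈ C, ∃ w, z < y w := fun z hz => by
    obtain ⟨z', hz', hzz'⟩ := hmax z hz
    obtain ⟨w, hw, hz'w⟩ := hWcof ⟨z', hz'⟩
    exact ⟨⟨w, hw⟩, hzz'.trans_le hz'w⟩
  by_cases hT : IsStationary {w | Order.IsSuccLimit w ∧ ¬ IsClosed (initialPart C y w)}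
  · obtain ⟨w, i, hi⟩ :=
      hR.exists_inter_Ici_subset_preimage hf hU hcov hC.isClosed hy hyC hcof hT
    refine ((hV (y w) (hyC w)).union
      (of_isClosed (hC.isClosed.inter isClosed_Ici) hi)).mono fun z ⟨hz, hcz⟩ => ?_
    exact (le_total z (y w)).imp (fun h => ⟨hcz, h⟩) fun h => ⟨hz, h⟩
  · exact inter_Ici_of_not_isStationary hC hy hcof hT fun w => hV (y w) (hyC w)

theorem inter_Iic (hR : IsOpenTournament R) (hf : Continuous f) (hU : ∀ i, IsOpen (U i))
    (hcov : ∀ x, ∃ i, x ∈ U i) (hC : IsClopen C)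
    (hV : ∀ z ∈ C, LocallyFinitelyCovered (fun i => f ⁻¹' U i) (Set.Icc z c)) :
    LocallyFinitelyCovered (fun i => f ⁻¹' U i) (C ∩ Set.Iic c) :=
  inter_Ici (Z := Zᵒᵈ) (f := f ∘ OrderDual.ofDual) (c := OrderDual.toDual c) hR hf hU hcov hC
    fun z hz => (hV z hz).mono fun _ hx => hx.symm

theorem univ (hR : IsOpenTournament R) (hf : Continuous f) (hU : ∀ i, IsOpen (U i))
    (hcov : ∀ x, ∃ i, x ∈ U i) : LocallyFinitelyCovered (fun i => f ⁻¹' U i) Set.univ := by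
  have hnear : ∀ z, ∀ᶠ x in 𝓝 z, LocallyFinitelyCovered (fun i => f ⁻¹' U i) (Set.uIcc x z) := by
    intro z
    obtain ⟨i, hi⟩ := hcov (f z)
    obtain ⟨N, hN, hNc, hNU⟩ := GeneralizedOrderedSpace.exists_ordConnected_subset z (f ⁻¹' U i)
      (((hU i).preimage hf).mem_nhds hi)
    filter_upwards [hN] with x hx
    exact of_isClosed isClosed_Icc ((hNc.uIcc_subset hx (mem_of_mem_nhds hN)).trans hNU)
  let r : Setoid Z :=
    { r x y := LocallyFinitelyCovered (fun i => f ⁻¹' U i) (Set.uIcc x y)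
      iseqv :=
        { refl z := (hnear z).self_of_nhds
          symm {x y} h := Set.uIcc_comm x y ▸ h
          trans h h' := (h.union h').mono Set.uIcc_subset_uIcc_union_uIcc } }
  have hr : IsLocallyConstant (Quotient.mk r) :=
    (IsLocallyConstant.iff_eventually_eq _).2 fun z => (hnear z).mono fun _ hx => Quotient.sound hx
  have hfin : LocallyFinite fun q => Quotient.mk r ⁻¹' {q} := fun z =>
    ⟨_, (hr.isOpen_fiber (Quotient.mk r z)).mem_nhds rfl, (Set.finite_singleton _).subset
      fun q ⟨x, hxq, hxz⟩ => hxq.symm.trans hxz⟩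
  refine (iUnion hfin (fun q => hr.isClosed_fiber q) fun q => ?_).mono
    fun z _ => Set.mem_iUnion.2 ⟨Quotient.mk r z, rfl⟩
  induction q using Quotient.inductionOn with | h c
  have hclass : ∀ z ∈ Quotient.mk r ⁻¹' {Quotient.mk r c},
      LocallyFinitelyCovered (fun i => f ⁻¹' U i) (Set.uIcc z c) := fun z hz => Quotient.exact hz
  have hright := inter_Ici (c := c) hR hf hU hcov (hr.isClopen_fiber (Quotient.mk r c))
    fun z hz => (hclass z hz).mono Set.Icc_subset_uIcc'
  have hleft := inter_Iic (c := c) hR hf hU hcov (hr.isClopen_fiber (Quotient.mk r c))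
    fun z hz => (hclass z hz).mono Set.Icc_subset_uIcc
  exact (hright.union hleft).mono fun z hz =>
    (le_total c z).imp (fun h => ⟨hz, h⟩) fun h => ⟨hz, h⟩

end LocallyFinitelyCovered

end GeneralizedOrderedSpace

section ClosedImage

variable {X : Type u} [TopologicalSpace X] {Z : Type v} [TopologicalSpace Z] {f : Z → X}
  {R : X × X → X × X → Prop}

theorem IsOpenTournament.paracompactSpace (hR : IsOpenTournament R)
    (hZ : SuborderableSpace.{v, w} Z) (hf : Continuous f) (hfc : IsClosedMap f)
    (hfs : f.Surjective) : ParacompactSpace X := by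
  obtain ⟨_, _⟩ := hZ.exists_generalizedOrderedSpace
  exact HasClosurePreservingRefinements.paracompactSpace fun ι U hU hcov =>
    (LocallyFinitelyCovered.univ hR hf hU hcov).exists_isClosurePreservingRefinement hfc hfs

theorem IsOpenTournament.hereditarilyParacompact (hR : IsOpenTournament R)
    (hZ : SuborderableSpace.{v, w} Z) (hf : Continuous f) (hfc : IsClosedMap f)
    (hfs : f.Surjective) : HereditarilyParacompact X := fun A =>
  (hR.comap (continuous_subtype_val.prodMap continuous_subtype_val)
    (Subtype.val_injective.prodMap Subtype.val_injective)).paracompactSpace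
      (hZ.subtype (f ⁻¹' A)) hf.restrictPreimage (hfc.restrictPreimage A)
      (Set.restrictPreimage_surjective A hfs)

end ClosedImage

/-- Total disconnectedness is taken in the strong sense (quasi-components are points): any two
distinct points are separated by a clopen set, which is Mathlib's `TotallySeparatedSpace`; it
implies `TotallyDisconnectedSpace`. -/
theorem corollary7p4 {X : Type u} [TopologicalSpace X] [T2Space X]
    {Z : Type v} [TopologicalSpace Z] (hZ : SuborderableSpace.{v, w} Z)
    (f : Z → X) (hf : Continuous f) (hfc : IsClosedMap f) (hfs : Function.Surjective f)
    (hX : ¬ DiscreteTopology X)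
    (hsel : AdmitsSepContWeakSelection (X × X)) :
    HereditarilyParacompact X ∧ TotallySeparatedSpace X ∧
      pseudoCharacter X ≤ approachingNumber X := by
  obtain ⟨R, hR⟩ := hsel.exists_isOpenTournament
  obtain ⟨p, A, hpA, hp, hA⟩ := exists_mem_closure_mk_le_approachingNumber hX
  have hE := hR.isClopenDiagonalFamily (x := ((↑) : A → X)) (fun x h => hpA (h.subst x.2))
    (by rwa [Subtype.range_coe])
  exact ⟨hR.hereditarilyParacompact hZ hf hfc hfs, hE.totallySeparatedSpace,
    hE.pseudoCharacter_le.trans hA⟩
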